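/- For each $n\ge 1$ let $(\mathcal S_n,K_n,\pi_n)$ be an irreducible, reversible discrete time Markov chain on a finite set $\mathcal S_n$, with transition matrix $K_n$ and stationary distribution $\pi_n$, and let $\mu_n$ be an initial probability distribution on $\mathcal S_n$. For $\theta\in(0,1)$ let $\mathcal F_\theta$ be the family of $\theta$-lazy discrete time chains with transition matrices $K_{n,\theta}=\theta I+(1-\theta)K_n$, and let $\mathcal F_c$ be the family of continuous time chains with semigroups $e^{t(K_n-I)}$, $t\ge 0$, all started from $\mu_n$. Put \[ d_n^{(\theta)}(m)=\Big(\sum_{y\in\mathcal S_n}\Big|\tfrac{\mu_nK_{n,\theta}^m(y)}{\pi_n(y)}-1\Big|^2\pi_n(y)\Big)^{1/2}\ (m\in\{0,1,2,\dots\}),\qquad d_n^{(c)}(t)=\Big(\sum_{y\in\mathcal S_n}\Big|\tfrac{\mu_ne^{t(K_n-I)}(y)}{\pi_n(y)}-1\Big|^2\pi_n(y)\Big)^{1/2}\ (t\ge 0), \] and, for $\epsilon>0$, let $T_n^{(\theta)}(\epsilon)=\min\{m\in\{0,1,2,\dots\}: d_n^{(\theta)}(m)\le\epsilon\}$ and $T_n^{(c)}(\epsilon)=\min\{t\ge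 0: d_n^{(c)}(t)\le\epsilon\}$ be the $L^2$-mixing times. The family $\mathcal F_\theta$ has an $L^2$-cutoff if there are $t_n>0$ such that, for all $a\in(0,1)$, $d_n^{(\theta)}(\lceil(1+a)t_n\rceil)\to 0$ and $d_n^{(\theta)}(\lfloor(1-a)t_n\rfloor)\to\infty$ as $n\to\infty$; the family $\mathcal F_c$ has an $L^2$-cutoff if the same holds for $d_n^{(c)}$ without the rounding. Assume that $\pi_n(|\mu_n/\pi_n|^2)=\sum_{y\in\mathcal S_n}\mu_n(y)^2/\pi_n(y)\to\infty$ as $n\to\infty$. Then the following hold. (1) For every $\theta\in[1/2,1)$: if $\mathcal F_\theta$ has an $L^2$-cutoff and $T_n^{(\theta)}(\epsilon_0)\to\infty$ for some $\epsilon_0>0$, then $\mathcal F_c$ has an $L^2$-cutoff. (2) If $\mathcal F_c$ has an $L^2$-cutoff and $T_n^{(c)}(\epsilon_0)\to\infty$ for some $\epsilon_0>0$, then $\mathcal F_\theta$ has an $L^2$-cutoff for every $\theta\in(1/2,1)$. (3) For every $\theta\in(1/2,1)$: if both $\mathcal F_c$ and $\mathcal F_\theta$ have $L^2$-cutoffs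 and there is $\epsilon_0>0$ such that $T_n^{(c)}(\epsilon_0)\to\infty$ or $T_n^{(\theta)}(\epsilon_0)\to\infty$, then \[ 1-\theta\le\liminf_{n\to\infty}\frac{T_n^{(c)}(\epsilon)}{T_n^{(\theta)}(\epsilon)}\le\limsup_{n\to\infty}\frac{T_n^{(c)}(\epsilon)}{T_n^{(\theta)}(\epsilon)}\le\frac{-\log(2\theta-1)}{2}\qquad\text{for all }\epsilon>0. \] -/

import Mathlib

open Set Filter Topology
open scoped ENNReal Matrix

namespace L2Cutoff

/-- `(S, K, π)` is an irreducible and reversible discrete time Markov chain on the finite set `S`: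
`K` is a stochastic matrix, `π` is a stationary probability, `K` is irreducible, and the
detailed balance equations hold. -/
structure IsReversibleChain {S : Type*} [Fintype S] [DecidableEq S]
    (K : Matrix S S ℝ) (π : S → ℝ) : Prop where
  stochastic : K ∈ Matrix.rowStochastic ℝ S
  prob : π ∈ stdSimplex ℝ S
  stationary : π ᵥ* K = π
  irreducible : K.IsIrreducible
  reversible : ∀ x y, π x * K x y = π y * K y x

/-- The `θ`-lazy version `K_θ = θ I + (1 - θ) K` of a transition matrix. -/
def lazy {S : Type*} [DecidableEq S] (θ : ℝ) (K : Matrix S S ℝ) : Matrix S S ℝ :=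
  θ • (1 : Matrix S S ℝ) + (1 - θ) • K

/-- The generator `L = K - I` of the continuous time chain associated with `K`. -/
def generator {S : Type*} [DecidableEq S] (K : Matrix S S ℝ) : Matrix S S ℝ :=
  K - 1

/-- `π(|μ/π|²)`, the second moment under `π` of the density of `μ` with respect to `π`. -/
noncomputable def densitySq {S : Type*} [Fintype S] (μ π : S → ℝ) : ℝ :=
  ∑ y, |μ y / π y| ^ 2 * π y

/-- `‖ν/π - 1‖_{L²(π)}`. -/
noncomputable def l2Dist {S : Type*} [Fintype S] (ν π : S → ℝ) : ℝ :=
  Real.sqrt (∑ y, |ν y / π y - 1| ^ 2 * π y)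

/-- The `L²`-distance `d₂(μ, m) = ‖μ K^m / π - 1‖_{L²(π)}` of the discrete time chain
`(μ, S, K, π)`. -/
noncomputable def discDist {S : Type*} [Fintype S] [DecidableEq S]
    (μ : S → ℝ) (K : Matrix S S ℝ) (π : S → ℝ) (m : ℕ) : ℝ :=
  l2Dist (μ ᵥ* K ^ m) π

/-- The `L²`-distance `d₂(μ, t) = ‖μ e^{tL} / π - 1‖_{L²(π)}` of the continuous time chain
`(μ, S, L, π)`; it is used at times `t ≥ 0`. -/
noncomputable def ctsDist {S : Type*} [Fintype S] [DecidableEq S]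
    (μ : S → ℝ) (L : Matrix S S ℝ) (π : S → ℝ) (t : ℝ) : ℝ :=
  l2Dist (μ ᵥ* NormedSpace.exp (t • L)) π

/-- The discrete time mixing time `min {m ∈ ℕ | d m ≤ ε}` (equal to `∞` if there is no such `m`). -/
noncomputable def discMixing (d : ℕ → ℝ) (ε : ℝ) : ℝ≥0∞ :=
  ⨅ (m : ℕ) (_ : d m ≤ ε), (m : ℝ≥0∞)

/-- The continuous time mixing time `min {t ≥ 0 | d t ≤ ε}` (equal to `∞` if there is no such `t`;
the infimum is attained when `d` is continuous). -/
noncomputable def ctsMixing (d : ℝ → ℝ) (ε : ℝ) : ℝ≥0∞ :=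
  ⨅ (t : ℝ) (_ : 0 ≤ t ∧ d t ≤ ε), ENNReal.ofReal t

/-- Discrete time cutoff for a sequence of distance functions. Since `t n > 0` and `0 < a < 1`,
the arguments are nonnegative and the natural number floor and ceiling are the usual ones. -/
def DiscCutoff (d : ℕ → ℕ → ℝ) : Prop :=
  ∃ t : ℕ → ℝ, (∀ n, 0 < t n) ∧ ∀ a ∈ Ioo (0 : ℝ) 1,
    Tendsto (fun n => d n ⌈(1 + a) * t n⌉₊) atTop (𝓝 0) ∧
    Tendsto (fun n => d n ⌊(1 - a) * t n⌋₊) atTop atTop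

/-- Continuous time cutoff for a sequence of distance functions. -/
def CtsCutoff (d : ℕ → ℝ → ℝ) : Prop :=
  ∃ t : ℕ → ℝ, (∀ n, 0 < t n) ∧ ∀ a ∈ Ioo (0 : ℝ) 1,
    Tendsto (fun n => d n ((1 + a) * t n)) atTop (𝓝 0) ∧
    Tendsto (fun n => d n ((1 - a) * t n)) atTop atTop

section Families

variable {S : ℕ → Type*} [∀ n, Fintype (S n)] [∀ n, DecidableEq (S n)]

/-- `L²`-distances of the chains in the `θ`-lazy family. -/
noncomputable def lazyFamDist (θ : ℝ) (μ : ∀ n, S n → ℝ) (K : ∀ n, Matrix (S n) (S n) ℝ)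
    (π : ∀ n, S n → ℝ) (n m : ℕ) : ℝ :=
  discDist (μ n) (lazy θ (K n)) (π n) m

/-- `L²`-distances of the chains in the associated continuous time family. -/
noncomputable def ctsFamDist (μ : ∀ n, S n → ℝ) (K : ∀ n, Matrix (S n) (S n) ℝ)
    (π : ∀ n, S n → ℝ) (n : ℕ) (t : ℝ) : ℝ :=
  ctsDist (μ n) (generator (K n)) (π n) t

/-- `L²`-mixing times of the chains in the `θ`-lazy family. -/
noncomputable def lazyMixing (θ : ℝ) (μ : ∀ n, S n → ℝ) (K : ∀ n, Matrix (S n) (S n) ℝ)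
    (π : ∀ n, S n → ℝ) (ε : ℝ) (n : ℕ) : ℝ≥0∞ :=
  discMixing (lazyFamDist θ μ K π n) ε

/-- `L²`-mixing times of the chains in the associated continuous time family. -/
noncomputable def contMixing (μ : ∀ n, S n → ℝ) (K : ∀ n, Matrix (S n) (S n) ℝ)
    (π : ∀ n, S n → ℝ) (ε : ℝ) (n : ℕ) : ℝ≥0∞ :=
  ctsMixing (ctsFamDist μ K π n) ε

end Families

end L2Cutoff

/-! Diagonalizing `K` in `L²(π)` gives weights `a i ≥ 0` and rates `x i = 1 - β i` in `[0, 2]` such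
that the squared distance is `∑ a i * exp (-2 t x i)` in continuous time and `∑ a i * (1 - (1 - θ) x
i) ^ (2m)` for the lazy chain. For `θ > 1/2` the latter is again a Laplace transform, with rates `ρ
i = -log (1 - (1 - θ) x i)`, and `(1 - θ) x ≤ ρ ≤ C x` with `C = -log (2θ - 1) / 2`.

Cutoff passes between the two families through a criterion insensitive to such a change of rates
(`exists_laplace_cutoff`): the mass at rates `≤ M / t n` tends to zero for every `M`, and the
transform blows up at some fixed multiple of `t n`. Normalizing at the time `s n` where the
transform equals one, almost all of its value comes from rates with `x * s n` large, so a shift by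
`± c * s n` drives it to zero or infinity.

For `θ = 1/2` a rate `ρ` may be infinite, but only small `x` matter once `t n → ∞`.

The ratio bounds come from comparing distances chain by chain; divergence of the mixing times
removes the rounding error. -/

namespace L2Cutoff

/-! ### Spectral decomposition of reversible chains -/

section Spectral

variable {S : Type*} [Fintype S] [DecidableEq S] {K : Matrix S S ℝ} {π : S → ℝ}

theorem vecMul_pow_eq_self (h : π ᵥ* K = π) (k : ℕ) : π ᵥ* K ^ k = π := by
  induction k with
  | zero => simp
  | succ k ih => rw [pow_succ, ← Matrix.vecMul_vecMul, ih, h]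

/-- Stationarity under a power of `K` carries mass from a charged state `x` to `y`. -/
theorem IsReversibleChain.pi_pos (h : IsReversibleChain K π) (y : S) : 0 < π y := by
  obtain ⟨x, hx⟩ : ∃ x, π x ≠ 0 := by
    by_contra! h0
    have := h.prob.2
    simp [h0] at this
  have hx : 0 < π x := lt_of_le_of_ne (h.prob.1 x) hx.symm
  obtain ⟨k, -, hk⟩ := (Matrix.isIrreducible_iff_exists_pow_pos h.irreducible.nonneg).1
    h.irreducible x y
  have hpow : K ^ k ∈ Matrix.rowStochastic ℝ S := pow_mem h.stochastic k
  rw [← congrFun (vecMul_pow_eq_self h.stationary k) y]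
  exact lt_of_lt_of_le (mul_pos hx hk) (Finset.single_le_sum (f := fun i => π i * (K ^ k) i y)
    (fun i _ => mul_nonneg (h.prob.1 i) (Matrix.nonneg_of_mem_rowStochastic hpow))
    (Finset.mem_univ x))

/-- Eigenvalues of a stochastic matrix (for row eigenvectors) have absolute value at most one. -/
theorem abs_le_one_of_vecMul_eq_smul (hK : K ∈ Matrix.rowStochastic ℝ S) {v : S → ℝ}
    (hv : v ≠ 0) {b : ℝ} (hb : v ᵥ* K = b • v) : |b| ≤ 1 := by
  obtain ⟨z, hz⟩ := Function.ne_iff.1 hv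
  have hpos : 0 < ∑ y, |v y| :=
    Finset.sum_pos' (fun _ _ => abs_nonneg _) ⟨z, Finset.mem_univ z, abs_pos.2 hz⟩
  -- Unit row sums and nonnegative entries make `v ↦ v ᵥ* K` an `ℓ¹` contraction.
  have hle : |b| * ∑ y, |v y| ≤ ∑ y, |v y| := by
    calc |b| * ∑ y, |v y| = ∑ y, |∑ x, v x * K x y| := by
          rw [Finset.mul_sum]
          refine Finset.sum_congr rfl fun y _ => ?_
          rw [← abs_mul]
          exact congrArg abs (congrFun hb y).symm
      _ ≤ ∑ y, ∑ x, |v x| * K x y := by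
          refine Finset.sum_le_sum fun y _ => (Finset.abs_sum_le_sum_abs _ _).trans_eq ?_
          refine Finset.sum_congr rfl fun x _ => ?_
          rw [abs_mul, abs_of_nonneg (Matrix.nonneg_of_mem_rowStochastic hK)]
      _ = ∑ x, |v x| := by
          rw [Finset.sum_comm]
          refine Finset.sum_congr rfl fun x _ => ?_
          rw [← Finset.mul_sum, Matrix.sum_row_of_mem_rowStochastic hK, mul_one]
  nlinarith

/-- A reversible transition matrix is diagonalized by a change of basis whose rows are orthonormal
in `L²(1/π)`. -/
theorem IsReversibleChain.exists_diagonalization (h : IsReversibleChain K π) :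
    ∃ (V W : Matrix S S ℝ) (β : S → ℝ), V * W = 1 ∧ W * V = 1 ∧ K = W * Matrix.diagonal β * V ∧
      (∀ b : S → ℝ, ∑ y, (b ᵥ* V) y ^ 2 / π y = ∑ i, b i ^ 2) ∧ ∀ i, |β i| ≤ 1 := by
  have hs : ∀ y, 0 < √(π y) := fun y => Real.sqrt_pos.2 (h.pi_pos y)
  have hs' : ∀ y, √(π y) ≠ 0 := fun y => (hs y).ne'
  have hsq : ∀ y, √(π y) ^ 2 = π y := fun y => Real.sq_sqrt (h.pi_pos y).le
  -- Detailed balance says exactly that the conjugate of `K` by `√π` is symmetric.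
  set D : Matrix S S ℝ := Matrix.diagonal fun y => √(π y)
  set E : Matrix S S ℝ := Matrix.diagonal fun y => (√(π y))⁻¹
  have hDE : D * E = 1 := by
    simp [D, E, Matrix.diagonal_mul_diagonal, hs']
  have hED : E * D = 1 := by
    simp [D, E, Matrix.diagonal_mul_diagonal, hs']
  have hA : (D * K * E).IsHermitian := by
    ext x y
    simp only [Matrix.conjTranspose_apply, star_trivial, D, E, Matrix.mul_diagonal,
      Matrix.diagonal_mul]
    rw [← div_eq_mul_inv, ← div_eq_mul_inv, div_eq_div_iff (hs' _) (hs' _)]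
    linear_combination (K y x) * hsq y - K x y * hsq x - h.reversible x y
  set U : Matrix S S ℝ := (hA.eigenvectorUnitary : Matrix S S ℝ)
  have hUU : U * star U = 1 := Unitary.coe_mul_star_self _
  have hUU' : star U * U = 1 := Unitary.coe_star_mul_self _
  have hspec : D * K * E = U * Matrix.diagonal hA.eigenvalues * star U := by
    simpa [Unitary.conjStarAlgAut_apply, Function.comp_def] using hA.spectral_theorem
  have hVW : star U * D * (E * U) = 1 := by
    rw [Matrix.mul_assoc, ← Matrix.mul_assoc D, hDE, Matrix.one_mul, hUU']
  have hWV : E * U * (star U * D) = 1 := by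
    rw [Matrix.mul_assoc, ← Matrix.mul_assoc U, hUU, Matrix.one_mul, hED]
  have hKeq : K = E * U * Matrix.diagonal hA.eigenvalues * (star U * D) := by
    calc K = E * D * K * (E * D) := by rw [hED, Matrix.one_mul, Matrix.mul_one]
      _ = E * (D * K * E) * D := by simp only [Matrix.mul_assoc]
      _ = _ := by simpa only [Matrix.mul_assoc] using congrArg (fun B => E * B * D) hspec
  refine ⟨star U * D, E * U, hA.eigenvalues, hVW, hWV, hKeq, fun b => ?_, fun i => ?_⟩
  · have : ∀ y, (b ᵥ* (star U * D)) y ^ 2 / π y = (b ᵥ* star U) y * (b ᵥ* star U) y := by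
      intro y
      rw [← Matrix.vecMul_vecMul, Matrix.vecMul_diagonal, mul_pow, hsq,
        mul_div_cancel_right₀ _ (h.pi_pos y).ne', sq]
    simp_rw [this]
    change (b ᵥ* star U) ⬝ᵥ (b ᵥ* star U) = _
    have hst : b ᵥ* star U = U *ᵥ b := by
      rw [Matrix.star_eq_conjTranspose, Matrix.conjTranspose_eq_transpose_of_trivial,
        Matrix.vecMul_transpose]
    nth_rewrite 2 [hst]
    rw [Matrix.dotProduct_mulVec, Matrix.vecMul_vecMul, hUU', Matrix.vecMul_one]
    simp [dotProduct, sq]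
  · refine abs_le_one_of_vecMul_eq_smul h.stochastic
      (v := Pi.single i 1 ᵥ* (star U * D)) (fun h0 => ?_) ?_
    · have := congrArg (fun w => w ᵥ* (E * U)) h0
      simp only [Matrix.vecMul_vecMul, hVW, Matrix.vecMul_one, Matrix.zero_vecMul] at this
      simpa using congrFun this i
    · have hVK : star U * D * K = Matrix.diagonal hA.eigenvalues * (star U * D) := by
        conv_lhs => rw [hKeq]
        rw [Matrix.mul_assoc (E * U), ← Matrix.mul_assoc (star U * D), hVW, Matrix.one_mul]
      rw [Matrix.vecMul_vecMul, hVK, ← Matrix.vecMul_vecMul, ← Matrix.smul_vecMul]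
      congr 1
      ext j
      rw [Matrix.vecMul_diagonal]
      by_cases hj : j = i
      · subst hj; simp
      · simp [hj]

omit [DecidableEq S] in
theorem l2Dist_eq_sqrt (hπ : ∀ y, 0 < π y) (ν : S → ℝ) :
    l2Dist ν π = √(∑ y, (ν - π) y ^ 2 / π y) := by
  unfold l2Dist
  congr 1
  refine Finset.sum_congr rfl fun y _ => ?_
  have := (hπ y).ne'
  rw [sq_abs, Pi.sub_apply]
  field_simp

/-- Spectral representation of the `L²`-distances of the lazy chains and of the semigroup. -/
theorem IsReversibleChain.exists_spectral (h : IsReversibleChain K π) (μ : S → ℝ) :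
    ∃ a x : S → ℝ, (∀ i, 0 ≤ a i) ∧ (∀ i, 0 ≤ x i) ∧ (∀ i, x i ≤ 2) ∧
      (∀ θ m, discDist μ (lazy θ K) π m = √(∑ i, a i * (1 - (1 - θ) * x i) ^ (2 * m))) ∧
      ∀ t, ctsDist μ (generator K) π t = √(∑ i, a i * Real.exp (-2 * t * x i)) := by
  obtain ⟨V, W, β, hVW, hWV, hK, hV, hβ⟩ := h.exists_diagonalization
  have hWinv : W = V⁻¹ := (Matrix.inv_eq_right_inv hVW).symm
  have hVunit : IsUnit V := IsUnit.of_mul_eq_one _ hVW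
  -- The condition on `p` makes `p(K)` fix `π`, which only has components at eigenvalue one. Hence
  -- `π` can be subtracted before the matrix is applied.
  have key : ∀ p : S → ℝ, (∀ i, β i = 1 → p i = 1) →
      l2Dist (μ ᵥ* (W * Matrix.diagonal p * V)) π
        = √(∑ i, ((μ - π) ᵥ* W) i ^ 2 * p i ^ 2) := by
    intro p hp
    have hstat : π ᵥ* (W * Matrix.diagonal p * V) = π := by
      have h1 : (π ᵥ* W) ᵥ* Matrix.diagonal β = π ᵥ* W := by
        conv_rhs => rw [← h.stationary, hK]
        simp only [Matrix.vecMul_vecMul, Matrix.mul_assoc, hVW, Matrix.mul_one]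
      have h2 : (π ᵥ* W) ᵥ* Matrix.diagonal p = π ᵥ* W := by
        ext i
        have h3 := congrFun h1 i
        rw [Matrix.vecMul_diagonal] at h3 ⊢
        by_cases hi : (π ᵥ* W) i = 0
        · simp [hi]
        · rw [hp i (mul_left_cancel₀ hi (h3.trans (mul_one _).symm)), mul_one]
      rw [← Matrix.vecMul_vecMul, ← Matrix.vecMul_vecMul, h2, Matrix.vecMul_vecMul, hWV,
        Matrix.vecMul_one]
    rw [l2Dist_eq_sqrt h.pi_pos]
    have hsub : μ ᵥ* (W * Matrix.diagonal p * V) - π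
        = (((μ - π) ᵥ* W) ᵥ* Matrix.diagonal p) ᵥ* V := by
      rw [Matrix.vecMul_vecMul, Matrix.vecMul_vecMul, Matrix.sub_vecMul, ← Matrix.mul_assoc, hstat]
    rw [hsub, hV]
    simp only [Matrix.vecMul_diagonal, mul_pow]
  have affine : ∀ r s : ℝ, r • (1 : Matrix S S ℝ) + s • K
      = W * Matrix.diagonal (fun i => r + s * β i) * V := by
    intro r s
    have hd : Matrix.diagonal (fun i => r + s * β i)
        = r • (1 : Matrix S S ℝ) + s • Matrix.diagonal β := by
      ext i j
      by_cases hij : i = j <;> simp [hij]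
    rw [hd, Matrix.mul_add, Matrix.add_mul, hK]
    simp [hWV]
  refine ⟨fun i => ((μ - π) ᵥ* W) i ^ 2, fun i => 1 - β i, fun i => sq_nonneg _,
    fun i => by linarith [(abs_le.1 (hβ i)).2], fun i => by linarith [(abs_le.1 (hβ i)).1],
    fun θ m => ?_, fun t => ?_⟩
  · have hlazy : lazy θ K = W * Matrix.diagonal (fun i => 1 - (1 - θ) * (1 - β i)) * V := by
      rw [lazy, affine]
      congr 3
      ext i; ring
    have hpow : lazy θ K ^ m
        = W * Matrix.diagonal (fun i => (1 - (1 - θ) * (1 - β i)) ^ m) * V := by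
      rw [hlazy]
      induction m with
      | zero => simp [hWV]
      | succ m ih =>
        rw [pow_succ, ih]
        calc _ = W * Matrix.diagonal (fun i => (1 - (1 - θ) * (1 - β i)) ^ m) * (V * W) *
              Matrix.diagonal (fun i => 1 - (1 - θ) * (1 - β i)) * V := by
              simp only [Matrix.mul_assoc]
          _ = _ := by
              rw [hVW, Matrix.mul_one, Matrix.mul_assoc W, Matrix.diagonal_mul_diagonal]
              simp only [pow_succ]
    rw [discDist, hpow, key _ fun i hi => by simp [hi]]
    simp only [← pow_mul, mul_comm m 2]
  · have hexp : NormedSpace.exp (t • generator K)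
        = W * Matrix.diagonal (fun i => Real.exp (-t * (1 - β i))) * V := by
      have hgen : t • generator K = V⁻¹ * Matrix.diagonal (fun i => -t * (1 - β i)) * V := by
        have : t • generator K = (-t) • (1 : Matrix S S ℝ) + t • K := by
          rw [generator, smul_sub, neg_smul]; abel
        rw [this, affine, ← hWinv]
        congr 3
        ext i; ring
      rw [hgen, Matrix.exp_conj' _ _ hVunit, Matrix.exp_diagonal, hWinv]
      congr 3
      ext i
      rw [Pi.coe_exp, Real.exp_eq_exp_ℝ]
    rw [ctsDist, hexp, key _ fun i hi => by simp [hi]]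
    congr 1
    refine Finset.sum_congr rfl fun i _ => ?_
    rw [← Real.exp_nat_mul]
    congr 2
    push_cast; ring

end Spectral

/-! ### Laplace transforms of finite measures and the cutoff criterion -/

section Laplace

variable {ι : Type*} [Fintype ι] {a x : ι → ℝ}

/-- The Laplace transform at `2 t` of the measure with mass `a i` at `x i`. -/
noncomputable def laplace (a x : ι → ℝ) (t : ℝ) : ℝ :=
  ∑ i, a i * Real.exp (-2 * t * x i)

open Classical in
/-- The mass of `(-∞, r]` under the measure with mass `a i` at `x i`. -/
noncomputable def lowMass (a x : ι → ℝ) (r : ℝ) : ℝ :=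
  ∑ i, if x i ≤ r then a i else 0

theorem continuous_laplace : Continuous (laplace a x) := by
  unfold laplace
  fun_prop

theorem laplace_nonneg (ha : ∀ i, 0 ≤ a i) (t : ℝ) : 0 ≤ laplace a x t :=
  Finset.sum_nonneg fun i _ => mul_nonneg (ha i) (Real.exp_nonneg _)

theorem lowMass_nonneg (ha : ∀ i, 0 ≤ a i) (r : ℝ) : 0 ≤ lowMass a x r :=
  Finset.sum_nonneg fun i _ => by split_ifs <;> simp [ha i]

theorem laplace_antitone (ha : ∀ i, 0 ≤ a i) (hx : ∀ i, 0 ≤ x i) : Antitone (laplace a x) := by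
  intro s t hst
  refine Finset.sum_le_sum fun i _ => mul_le_mul_of_nonneg_left (Real.exp_le_exp.2 ?_) (ha i)
  nlinarith [mul_le_mul_of_nonneg_right hst (hx i)]

theorem laplace_le_laplace (ha : ∀ i, 0 ≤ a i) {y : ι → ℝ} {s t : ℝ}
    (h : ∀ i, t * y i ≤ s * x i) : laplace a x s ≤ laplace a y t := by
  refine Finset.sum_le_sum fun i _ => mul_le_mul_of_nonneg_left (Real.exp_le_exp.2 ?_) (ha i)
  linarith [h i]

theorem lowMass_le_lowMass (ha : ∀ i, 0 ≤ a i) {y : ι → ℝ} {r s : ℝ}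
    (h : ∀ i, x i ≤ r → y i ≤ s) : lowMass a x r ≤ lowMass a y s := by
  refine Finset.sum_le_sum fun i _ => ?_
  by_cases hi : x i ≤ r
  · rw [if_pos hi, if_pos (h i hi)]
  · rw [if_neg hi]
    split_ifs <;> simp [ha i]

theorem lowMass_mul_le_sum (ha : ∀ i, 0 ≤ a i) {r c : ℝ} {q : ι → ℝ} (hq : ∀ i, 0 ≤ q i)
    (h : ∀ i, x i ≤ r → c ≤ q i) : lowMass a x r * c ≤ ∑ i, a i * q i := by
  rw [lowMass, Finset.sum_mul]
  refine Finset.sum_le_sum fun i _ => ?_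
  split_ifs with hi
  · exact mul_le_mul_of_nonneg_left (h i hi) (ha i)
  · rw [zero_mul]
    exact mul_nonneg (ha i) (hq i)

theorem lowMass_mul_exp_le (ha : ∀ i, 0 ≤ a i) {t : ℝ} (ht : 0 ≤ t) (r : ℝ) :
    lowMass a x r * Real.exp (-2 * t * r) ≤ laplace a x t := by
  refine lowMass_mul_le_sum ha (fun i => Real.exp_nonneg _) fun i hi => Real.exp_le_exp.2 ?_
  nlinarith [mul_le_mul_of_nonneg_left hi ht]

/-- Rates at most `r` contribute no more than their mass; each larger rate loses a factor `exp (-2 t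
r)` over the extra time `t`. -/
theorem laplace_add_le (ha : ∀ i, 0 ≤ a i) (hx : ∀ i, 0 ≤ x i) {s t : ℝ} (hs : 0 ≤ s)
    (ht : 0 ≤ t) (r : ℝ) :
    laplace a x (s + t) ≤ lowMass a x r + Real.exp (-2 * t * r) * laplace a x s := by
  rw [laplace, laplace, lowMass, Finset.mul_sum, ← Finset.sum_add_distrib]
  refine Finset.sum_le_sum fun i _ => ?_
  have hsplit : Real.exp (-2 * (s + t) * x i)
      = Real.exp (-2 * t * x i) * Real.exp (-2 * s * x i) := by
    rw [← Real.exp_add]; ring_nf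
  split_ifs with hi
  · have h1 : Real.exp (-2 * (s + t) * x i) ≤ 1 := by
      rw [Real.exp_le_one_iff]
      nlinarith [mul_nonneg (add_nonneg hs ht) (hx i)]
    have h2 : 0 ≤ Real.exp (-2 * t * r) * (a i * Real.exp (-2 * s * x i)) :=
      mul_nonneg (Real.exp_nonneg _) (mul_nonneg (ha i) (Real.exp_nonneg _))
    nlinarith [mul_le_mul_of_nonneg_left h1 (ha i)]
  · have h1 : Real.exp (-2 * t * x i) ≤ Real.exp (-2 * t * r) := by
      refine Real.exp_le_exp.2 ?_
      nlinarith [mul_le_mul_of_nonneg_left (not_le.1 hi).le ht]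
    rw [zero_add, hsplit]
    have := mul_le_mul_of_nonneg_right h1 (mul_nonneg (ha i) (Real.exp_nonneg (-2 * s * x i)))
    linarith

/-- Counterpart backwards in time: after discarding rates at most `r`, what remains at time `s`
grows by at least `exp (2 t r)`. -/
theorem le_laplace_sub (ha : ∀ i, 0 ≤ a i) (hx : ∀ i, 0 ≤ x i) {s t : ℝ} (hs : 0 ≤ s)
    (ht : 0 ≤ t) (r : ℝ) :
    Real.exp (2 * t * r) * (laplace a x s - lowMass a x r) ≤ laplace a x (s - t) := by
  rw [laplace, laplace, lowMass, ← Finset.sum_sub_distrib, Finset.mul_sum]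
  refine Finset.sum_le_sum fun i _ => ?_
  have hsplit : Real.exp (-2 * (s - t) * x i)
      = Real.exp (2 * t * x i) * Real.exp (-2 * s * x i) := by
    rw [← Real.exp_add]; ring_nf
  split_ifs with hi
  · have h1 : Real.exp (-2 * s * x i) ≤ 1 := by
      rw [Real.exp_le_one_iff]
      nlinarith [mul_nonneg hs (hx i)]
    have h2 := mul_le_mul_of_nonneg_left h1 (ha i)
    have h3 : 0 ≤ a i * Real.exp (-2 * (s - t) * x i) := mul_nonneg (ha i) (Real.exp_nonneg _)
    nlinarith [mul_nonneg (Real.exp_nonneg (2 * t * r)) (sub_nonneg.2 h2)]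
  · have h1 : Real.exp (2 * t * r) ≤ Real.exp (2 * t * x i) := by
      refine Real.exp_le_exp.2 ?_
      nlinarith [mul_le_mul_of_nonneg_left (not_le.1 hi).le ht]
    rw [sub_zero, hsplit]
    have := mul_le_mul_of_nonneg_right h1 (mul_nonneg (ha i) (Real.exp_nonneg (-2 * s * x i)))
    linarith

/-- If the mass near zero is less than one half and the Laplace transform exceeds one at `t`, then
it equals one at some later time. -/
theorem exists_laplace_eq_one (ha : ∀ i, 0 ≤ a i) (hx : ∀ i, 0 ≤ x i) {r t : ℝ} (hr : 0 < r)
    (ht : 0 ≤ t) (hlow : lowMass a x r < 1 / 2) (h1 : 1 < laplace a x t) :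
    ∃ s, t ≤ s ∧ laplace a x s = 1 := by
  -- The part of the transform above rate `r` decays, so the total eventually drops below `1/2 +
  -- 1/2` and the intermediate value theorem applies.
  have hlim : Tendsto (fun u : ℝ => Real.exp (-2 * u * r) * laplace a x t) atTop (𝓝 0) := by
    have h2 : Tendsto (fun u : ℝ => -2 * u * r) atTop atBot := by
      have : (fun u : ℝ => -2 * u * r) = fun u => (-2 * r) * u := by ext; ring
      rw [this]
      exact tendsto_id.const_mul_atTop_of_neg (by linarith)
    simpa using (Real.tendsto_exp_atBot.comp h2).mul_const (laplace a x t)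
  obtain ⟨u, hu, hu0⟩ := ((hlim.eventually_lt_const (by norm_num : (0 : ℝ) < 1 / 2)).and
    (eventually_ge_atTop 0)).exists
  have hle : laplace a x (t + u) ≤ 1 := by
    linarith [laplace_add_le ha hx ht hu0 r]
  obtain ⟨s, hs, hs1⟩ := intermediate_value_Icc' (by linarith : t ≤ t + u)
    continuous_laplace.continuousOn ⟨hle, h1.le⟩
  exact ⟨s, hs.1, hs1⟩

end Laplace

/-- If the mass of `(-∞, M / t n]` vanishes for all `M` and the Laplace transforms blow up at
times proportional to `t n`, then they exhibit a cutoff. -/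
theorem exists_laplace_cutoff {ι : ℕ → Type*} [∀ n, Fintype (ι n)] {a x : ∀ n, ι n → ℝ}
    (ha : ∀ n i, 0 ≤ a n i) (hx : ∀ n i, 0 ≤ x n i) {t : ℕ → ℝ} (ht : ∀ n, 0 < t n)
    (hlow : ∀ M, 0 < M → Tendsto (fun n => lowMass (a n) (x n) (M / t n)) atTop (𝓝 0))
    {b : ℝ} (hb : 0 < b) (hbig : Tendsto (fun n => laplace (a n) (x n) (b * t n)) atTop atTop) :
    ∃ s : ℕ → ℝ, (∀ n, 0 < s n) ∧ ∀ c ∈ Ioo (0 : ℝ) 1,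
      Tendsto (fun n => laplace (a n) (x n) ((1 + c) * s n)) atTop (𝓝 0) ∧
      Tendsto (fun n => laplace (a n) (x n) ((1 - c) * s n)) atTop atTop := by
  have hex : ∀ n, ∃ s, 0 < s ∧ (lowMass (a n) (x n) (1 / t n) < 1 / 2 →
      1 < laplace (a n) (x n) (b * t n) → b * t n ≤ s ∧ laplace (a n) (x n) s = 1) := by
    intro n
    have hbt := mul_pos hb (ht n)
    by_cases h : lowMass (a n) (x n) (1 / t n) < 1 / 2 ∧ 1 < laplace (a n) (x n) (b * t n)
    · obtain ⟨s, hs, hs1⟩ := exists_laplace_eq_one (ha n) (hx n) (one_div_pos.2 (ht n)) hbt.le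
        h.1 h.2
      exact ⟨s, hbt.trans_le hs, fun _ _ => ⟨hs, hs1⟩⟩
    -- Default value, used for only finitely many `n`.
    · exact ⟨1, one_pos, fun h1 h2 => absurd ⟨h1, h2⟩ h⟩
  choose s hs0 hs using hex
  have hev : ∀ᶠ n in atTop, b * t n ≤ s n ∧ laplace (a n) (x n) (s n) = 1 := by
    filter_upwards [(hlow 1 one_pos).eventually_lt_const (by norm_num : (0 : ℝ) < 1 / 2),
      hbig.eventually_gt_atTop 1] with n h1 h2 using hs n h1 h2
  -- Since `s n ≥ b * t n`, the rates below `M / s n` lie below `(M / b) / t n`.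
  have hlow' : ∀ M, 0 < M → Tendsto (fun n => lowMass (a n) (x n) (M / s n)) atTop (𝓝 0) := by
    intro M hM
    refine squeeze_zero' (Eventually.of_forall fun n => lowMass_nonneg (ha n) _) ?_
      (hlow (M / b) (div_pos hM hb))
    filter_upwards [hev] with n hn
    refine lowMass_le_lowMass (ha n) fun i hi => hi.trans ?_
    rw [div_div]
    exact div_le_div_of_nonneg_left hM.le (mul_pos hb (ht n)) hn.1
  refine ⟨s, hs0, fun c hc => ⟨?_, ?_⟩⟩
  · refine tendsto_order.2 ⟨fun ε hε => Eventually.of_forall fun n =>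
      hε.trans_le (laplace_nonneg (ha n) _), fun ε hε => ?_⟩
    obtain ⟨M, hM, hM0⟩ : ∃ M : ℝ, Real.exp (-(2 * c) * M) < ε / 2 ∧ 0 < M := by
      have h2 : Tendsto (fun M : ℝ => Real.exp (-(2 * c) * M)) atTop (𝓝 0) :=
        Real.tendsto_exp_atBot.comp
          (tendsto_id.const_mul_atTop_of_neg (by linarith [hc.1]))
      exact ((h2.eventually_lt_const (half_pos hε)).and (eventually_gt_atTop 0)).exists
    filter_upwards [hev, (hlow' M hM0).eventually_lt_const (half_pos hε)] with n hn hn'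
    have h3 := laplace_add_le (ha n) (hx n) (hs0 n).le (mul_pos hc.1 (hs0 n)).le (M / s n)
    have h4 : -2 * (c * s n) * (M / s n) = -(2 * c) * M := by
      have := (hs0 n).ne'
      field_simp
    rw [hn.2, h4, mul_one] at h3
    rw [add_mul, one_mul]
    linarith
  -- At `s n` more than half of the total value one comes from rates above `M / s n`; going back by
  -- `c * s n` multiplies that half by at least `exp (2 c M) ≥ 2 |B|`.
  · refine tendsto_atTop.2 fun B => ?_
    obtain ⟨M, hM, hM0⟩ : ∃ M : ℝ, 2 * |B| ≤ Real.exp (2 * c * M) ∧ 0 < M := by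
      have h2 : Tendsto (fun M : ℝ => Real.exp (2 * c * M)) atTop atTop :=
        Real.tendsto_exp_atTop.comp (tendsto_id.const_mul_atTop (by linarith [hc.1]))
      exact ((h2.eventually_ge_atTop _).and (eventually_gt_atTop 0)).exists
    filter_upwards [hev, (hlow' M hM0).eventually_lt_const (by norm_num : (0 : ℝ) < 1 / 2)]
      with n hn hn'
    have h3 := le_laplace_sub (ha n) (hx n) (hs0 n).le (mul_pos hc.1 (hs0 n)).le (M / s n)
    have h4 : 2 * (c * s n) * (M / s n) = 2 * c * M := by
      have := (hs0 n).ne'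
      field_simp
    rw [hn.2, h4] at h3
    rw [sub_mul, one_mul]
    nlinarith [le_abs_self B, abs_nonneg B, Real.exp_pos (2 * c * M)]

/-! ### Scalar comparison of lazy and exponential decay -/

section Bounds

theorem one_sub_mul_nonneg {θ x : ℝ} (hθ : 1 / 2 ≤ θ) (hx0 : 0 ≤ x) (hx2 : x ≤ 2) :
    0 ≤ 1 - (1 - θ) * x := by
  nlinarith

theorem pow_one_sub_le_exp {θ x : ℝ} (hθ : 1 / 2 ≤ θ) (hx0 : 0 ≤ x) (hx2 : x ≤ 2) (m : ℕ) :
    (1 - (1 - θ) * x) ^ (2 * m) ≤ Real.exp (-2 * ((1 - θ) * m) * x) := by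
  calc (1 - (1 - θ) * x) ^ (2 * m) ≤ Real.exp (-((1 - θ) * x)) ^ (2 * m) :=
        pow_le_pow_left₀ (one_sub_mul_nonneg hθ hx0 hx2) (Real.one_sub_le_exp_neg _) _
    _ = _ := by
        rw [← Real.exp_nat_mul]
        congr 1
        push_cast; ring

/-- Bernoulli's inequality for `(2θ - 1) ^ (x / 2)` with exponent in `[0, 1]`; equality at `x = 2`
makes the constant sharp. -/
theorem exp_le_one_sub {θ x : ℝ} (hθ : 1 / 2 < θ) (hx0 : 0 ≤ x) (hx2 : x ≤ 2) :
    Real.exp (-(-Real.log (2 * θ - 1) / 2 * x)) ≤ 1 - (1 - θ) * x := by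
  have h := rpow_one_add_le_one_add_mul_self (s := 2 * θ - 2) (by linarith) (p := x / 2)
    (by linarith) (by linarith)
  rw [Real.rpow_def_of_pos (by linarith)] at h
  convert h using 2 <;> ring_nf

/-- Substitute for `exp_le_one_sub` that survives at `θ = 1/2`, via `exp (-x) ≤ 1 / (1 + x) ≤ 1 - x
/ 2` on `[0, 1]`. -/
theorem exp_neg_le_one_sub {θ x : ℝ} (hθ : 1 / 2 ≤ θ) (hx0 : 0 ≤ x) (hx1 : x ≤ 1) :
    Real.exp (-x) ≤ 1 - (1 - θ) * x := by
  have h : 1 - x / 2 ≤ 1 - (1 - θ) * x := by nlinarith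
  refine le_trans ?_ h
  rw [Real.exp_neg, inv_le_comm₀ (Real.exp_pos _) (by linarith)]
  have h1 := Real.add_one_le_exp x
  refine le_trans ?_ h1
  rw [inv_le_comm₀ (by linarith) (by linarith), inv_le_iff_one_le_mul₀ (by linarith)]
  nlinarith

end Bounds

/-! ### Mixing times: comparison and divergence -/

section Mixing

variable {dc : ℝ → ℝ} {dd : ℕ → ℝ} {C κ : ℝ}

theorem discMixing_le {m : ℕ} {ε : ℝ} (h : dd m ≤ ε) : discMixing dd ε ≤ m :=
  iInf₂_le m h

theorem ctsMixing_le_mul_discMixing (hC : 0 < C) (h : ∀ m : ℕ, dc (C * m) ≤ dd m) (ε : ℝ) :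
    ctsMixing dc ε ≤ ENNReal.ofReal C * discMixing dd ε := by
  have hC0 : ENNReal.ofReal C ≠ 0 := (ENNReal.ofReal_pos.2 hC).ne'
  simp only [discMixing, ENNReal.mul_iInf_of_ne hC0 ENNReal.ofReal_ne_top]
  refine le_iInf₂ fun m hm => ?_
  rw [← ENNReal.ofReal_natCast, ← ENNReal.ofReal_mul hC.le]
  exact iInf₂_le (C * m : ℝ) ⟨by positivity, (h m).trans hm⟩

/-- Rounding `t / κ` up to an integer costs at most one step, hence the subtracted `κ`. -/
theorem mul_discMixing_sub_le_ctsMixing (hκ : 0 < κ) (hdc : Antitone dc)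
    (h : ∀ m : ℕ, dd m ≤ dc (κ * m)) (ε : ℝ) :
    ENNReal.ofReal κ * discMixing dd ε - ENNReal.ofReal κ ≤ ctsMixing dc ε := by
  refine le_iInf₂ fun t ht => tsub_le_iff_right.2 ?_
  have hle : κ * (t / κ) ≤ κ * ⌈t / κ⌉₊ := mul_le_mul_of_nonneg_left (Nat.le_ceil _) hκ.le
  rw [mul_div_cancel₀ _ hκ.ne'] at hle
  have hm : discMixing dd ε ≤ (⌈t / κ⌉₊ : ℝ≥0∞) :=
    discMixing_le ((h _).trans ((hdc hle).trans ht.2))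
  calc ENNReal.ofReal κ * discMixing dd ε ≤ ENNReal.ofReal κ * (⌈t / κ⌉₊ : ℝ≥0∞) := by gcongr
    _ = ENNReal.ofReal (κ * ⌈t / κ⌉₊) := by
        rw [ENNReal.ofReal_mul hκ.le, ENNReal.ofReal_natCast]
    _ ≤ ENNReal.ofReal (t + κ) := by
        refine ENNReal.ofReal_le_ofReal ?_
        have h1 := mul_le_mul_of_nonneg_left (Nat.ceil_lt_add_one (div_nonneg ht.1 hκ.le)).le hκ.le
        rwa [mul_add, mul_div_cancel₀ _ hκ.ne', mul_one] at h1
    _ = _ := ENNReal.ofReal_add ht.1 hκ.le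

variable {d : ℕ → ℕ → ℝ} {t : ℕ → ℝ}

/-- Eventually the mixing time is at most `⌈(3/2) * t n⌉`. With the next lemma, this spreads
divergence from one `ε` to all. -/
theorem tendsto_atTop_of_discMixing
    (ht : ∀ n, 0 < t n) (hd : Tendsto (fun n => d n ⌈(1 + 1 / 2) * t n⌉₊) atTop (𝓝 0)) {ε : ℝ}
    (hε : 0 < ε) (hT : Tendsto (fun n => discMixing (d n) ε) atTop (𝓝 ∞)) :
    Tendsto t atTop atTop := by
  refine tendsto_atTop.2 fun B => ?_
  filter_upwards [hd.eventually_lt_const hε, hT.eventually_const_lt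
    (ENNReal.ofReal_lt_top (r := (1 + 1 / 2) * B + 1))] with n h1 h2
  have h3 : ENNReal.ofReal ((1 + 1 / 2) * B + 1) < ENNReal.ofReal ⌈(1 + 1 / 2) * t n⌉₊ := by
    rw [ENNReal.ofReal_natCast]
    exact h2.trans_le (discMixing_le h1.le)
  have h4 := (ENNReal.ofReal_lt_ofReal_iff'.1 h3).1
  have h5 := Nat.ceil_lt_add_one (mul_nonneg (by norm_num : (0 : ℝ) ≤ 1 + 1 / 2) (ht n).le)
  linarith

theorem tendsto_discMixing_of_tendsto_atTop (hanti : ∀ n, Antitone (d n))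
    (ht : Tendsto t atTop atTop)
    (hd : Tendsto (fun n => d n ⌊(1 - 1 / 2) * t n⌋₊) atTop atTop) (ε : ℝ) :
    Tendsto (fun n => discMixing (d n) ε) atTop (𝓝 ∞) := by
  have h1 : Tendsto (fun n => ((⌊(1 - 1 / 2) * t n⌋₊ : ℕ) : ℝ≥0∞)) atTop (𝓝 ∞) :=
    ENNReal.tendsto_nat_nhds_top.comp
      (tendsto_nat_floor_atTop.comp (ht.const_mul_atTop (by norm_num)))
  refine tendsto_nhds_top_mono h1 ?_
  filter_upwards [hd.eventually_gt_atTop ε] with n hn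
  refine le_iInf₂ fun m hm => Nat.cast_le.2 ?_
  by_contra! hlt
  exact absurd (hn.trans_le (hanti n hlt.le)) (not_lt.2 hm)

theorem discMixing_eventually_ne_top
    (hd : Tendsto (fun n => d n ⌈(1 + 1 / 2) * t n⌉₊) atTop (𝓝 0)) {ε : ℝ} (hε : 0 < ε) :
    ∀ᶠ n in atTop, discMixing (d n) ε ≠ ∞ := by
  filter_upwards [hd.eventually_lt_const hε] with n hn
  exact ne_top_of_le_ne_top (ENNReal.natCast_ne_top _) (discMixing_le hn.le)

/-- If `κ T - κ ≤ U` and `T → ∞` through finite values, then `κ ≤ liminf U / T`. -/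
theorem le_liminf_div_of_mul_sub_le {U T : ℕ → ℝ≥0∞} {k : ℝ≥0∞} (hk : k ≠ ∞)
    (h : ∀ n, k * T n - k ≤ U n) (hT : Tendsto T atTop (𝓝 ∞)) (hT' : ∀ᶠ n in atTop, T n ≠ ∞) :
    k ≤ liminf (fun n => U n / T n) atTop := by
  have hlim : Tendsto (fun n => k - k / T n) atTop (𝓝 k) := by
    have h1 : Tendsto (fun n => k / T n) atTop (𝓝 0) := by
      simpa using ENNReal.Tendsto.const_div hT (Or.inr hk)
    simpa using ENNReal.Tendsto.sub (tendsto_const_nhds (x := k)) h1 (Or.inl hk)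
  rw [← hlim.liminf_eq]
  refine liminf_le_liminf ?_
  filter_upwards [hT', hT.eventually_const_lt ENNReal.zero_lt_top] with n hn hn0
  calc k - k / T n = (k * T n - k) / T n := by
        rw [ENNReal.sub_div fun _ _ => hn0.ne', ENNReal.mul_div_cancel_right hn0.ne' hn]
    _ ≤ U n / T n := by gcongr; exact h n

end Mixing

/-! ### Monotonicity and comparison of distances for one chain -/

section Chain

variable {S : Type*} [Fintype S] [DecidableEq S] {K : Matrix S S ℝ} {π : S → ℝ}

theorem IsReversibleChain.antitone_ctsDist (h : IsReversibleChain K π) (μ : S → ℝ) :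
    Antitone (ctsDist μ (generator K) π) := by
  obtain ⟨a, x, ha, hx0, -, -, hc⟩ := h.exists_spectral μ
  intro s t hst
  rw [hc, hc]
  exact Real.sqrt_le_sqrt (laplace_antitone ha hx0 hst)

theorem IsReversibleChain.antitone_discDist (h : IsReversibleChain K π) (μ : S → ℝ) {θ : ℝ}
    (hθ : 1 / 2 ≤ θ) (hθ1 : θ ≤ 1) : Antitone (discDist μ (lazy θ K) π) := by
  obtain ⟨a, x, ha, hx0, hx2, hd, -⟩ := h.exists_spectral μ
  intro k m hkm
  rw [hd, hd]
  refine Real.sqrt_le_sqrt (Finset.sum_le_sum fun i _ => mul_le_mul_of_nonneg_left ?_ (ha i))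
  refine pow_le_pow_of_le_one (one_sub_mul_nonneg hθ (hx0 i) (hx2 i)) ?_ (by lia)
  linarith [mul_nonneg (sub_nonneg.2 hθ1) (hx0 i)]

theorem IsReversibleChain.discDist_le_ctsDist (h : IsReversibleChain K π) (μ : S → ℝ) {θ : ℝ}
    (hθ : 1 / 2 ≤ θ) (m : ℕ) :
    discDist μ (lazy θ K) π m ≤ ctsDist μ (generator K) π ((1 - θ) * m) := by
  obtain ⟨a, x, ha, hx0, hx2, hd, hc⟩ := h.exists_spectral μ
  rw [hd, hc]
  exact Real.sqrt_le_sqrt (Finset.sum_le_sum fun i _ =>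
    mul_le_mul_of_nonneg_left (pow_one_sub_le_exp hθ (hx0 i) (hx2 i) m) (ha i))

theorem IsReversibleChain.ctsDist_le_discDist (h : IsReversibleChain K π) (μ : S → ℝ) {θ : ℝ}
    (hθ : 1 / 2 < θ) (m : ℕ) :
    ctsDist μ (generator K) π (-Real.log (2 * θ - 1) / 2 * m) ≤ discDist μ (lazy θ K) π m := by
  obtain ⟨a, x, ha, hx0, hx2, hd, hc⟩ := h.exists_spectral μ
  rw [hd, hc]
  refine Real.sqrt_le_sqrt (Finset.sum_le_sum fun i _ => mul_le_mul_of_nonneg_left ?_ (ha i))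
  refine le_trans (le_of_eq ?_)
    (pow_le_pow_left₀ (Real.exp_nonneg _) (exp_le_one_sub hθ (hx0 i) (hx2 i)) (2 * m))
  rw [← Real.exp_nat_mul]
  congr 1
  push_cast; ring

end Chain

theorem tendsto_atTop_of_tendsto_sqrt {f : ℕ → ℝ} (hf : ∀ n, 0 ≤ f n)
    (h : Tendsto (fun n => √(f n)) atTop atTop) : Tendsto f atTop atTop :=
  ((tendsto_pow_atTop two_ne_zero).comp h).congr fun n => Real.sq_sqrt (hf n)

theorem tendsto_sqrt_zero {f : ℕ → ℝ} (h : Tendsto f atTop (𝓝 0)) :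
    Tendsto (fun n => √(f n)) atTop (𝓝 0) :=
  (Real.continuous_sqrt.tendsto' 0 0 Real.sqrt_zero).comp h

theorem tendsto_zero_of_tendsto_sqrt {f : ℕ → ℝ} (hf : ∀ n, 0 ≤ f n)
    (h : Tendsto (fun n => √(f n)) atTop (𝓝 0)) : Tendsto f atTop (𝓝 0) := by
  simpa [Real.sq_sqrt (hf _)] using h.pow 2

/-! ### Transfer of cutoff between the families -/

section Families

variable {S : ℕ → Type*} [∀ n, Fintype (S n)] [∀ n, DecidableEq (S n)]
  {K : ∀ n, Matrix (S n) (S n) ℝ} {π : ∀ n, S n → ℝ}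

theorem ctsCutoff_of_discCutoff (hK : ∀ n, IsReversibleChain (K n) (π n)) (μ : ∀ n, S n → ℝ)
    {θ : ℝ} (hθ : 1 / 2 ≤ θ) (hθ1 : θ < 1) (hcut : DiscCutoff (lazyFamDist θ μ K π)) {ε : ℝ}
    (hε : 0 < ε) (hT : Tendsto (lazyMixing θ μ K π ε) atTop (𝓝 ∞)) :
    CtsCutoff (ctsFamDist μ K π) := by
  obtain ⟨t, ht, htc⟩ := hcut
  obtain ⟨hd0, hdtop⟩ := htc (1 / 2) ⟨by norm_num, by norm_num⟩
  have htop : Tendsto t atTop atTop := tendsto_atTop_of_discMixing ht hd0 hε hT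
  have hκ : 0 < 1 - θ := by linarith
  choose a x ha hx0 hx2 hd hc using fun n => (hK n).exists_spectral (μ n)
  have hcts : ∀ n s, ctsFamDist μ K π n s = √(laplace (a n) (x n) s) := fun n s => hc n s
  have hdisc : ∀ n m, lazyFamDist θ μ K π n m
      = √(∑ i, a n i * (1 - (1 - θ) * x n i) ^ (2 * m)) := fun n m => hd n θ m
  have hq : ∀ n m i, 0 ≤ (1 - (1 - θ) * x n i) ^ (2 * m) := fun n m i =>
    pow_nonneg (one_sub_mul_nonneg hθ (hx0 n i) (hx2 n i)) _
  have hlow : ∀ M, 0 < M → Tendsto (fun n => lowMass (a n) (x n) (M / t n)) atTop (𝓝 0) := by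
    intro M hM
    simp only [hdisc] at hd0
    have h0 := (tendsto_zero_of_tendsto_sqrt (fun n => Finset.sum_nonneg fun i _ =>
      mul_nonneg (ha n i) (hq n _ i)) hd0).mul_const (Real.exp (6 * M))
    rw [zero_mul] at h0
    refine squeeze_zero' (Eventually.of_forall fun n => lowMass_nonneg (ha n) _) ?_ h0
    -- `t n ≥ M` puts the relevant rates in `[0, 1]`; `t n ≥ 1` absorbs the rounding in `m ≤ 3 * t
    -- n`, so that `2 * m * x ≤ 6 * M`.
    filter_upwards [htop.eventually_ge_atTop 1, htop.eventually_ge_atTop M] with n hn1 hnM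
    set m := ⌈(1 + 1 / 2) * t n⌉₊
    have hm : (m : ℝ) ≤ 3 * t n := by
      have := Nat.ceil_lt_add_one (mul_nonneg (by norm_num : (0 : ℝ) ≤ 1 + 1 / 2) (ht n).le)
      change (m : ℝ) < _ at this
      linarith
    have h1 := lowMass_mul_le_sum (x := x n) (r := M / t n) (c := Real.exp (-(6 * M))) (ha n)
      (hq n m) fun i hi => by
        have hi1 : x n i ≤ 1 := hi.trans ((div_le_one (ht n)).2 hnM)
        refine le_trans ?_ (pow_le_pow_left₀ (Real.exp_nonneg _)
          (exp_neg_le_one_sub hθ (hx0 n i) hi1) (2 * m))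
        rw [← Real.exp_nat_mul, Real.exp_le_exp]
        have h2 : (m : ℝ) * x n i ≤ 3 * t n * (M / t n) :=
          mul_le_mul hm hi (hx0 n i) (by linarith)
        rw [mul_assoc, mul_div_cancel₀ _ (ht n).ne'] at h2
        push_cast
        linarith
    calc lowMass (a n) (x n) (M / t n)
        = lowMass (a n) (x n) (M / t n) * Real.exp (-(6 * M)) * Real.exp (6 * M) := by
          rw [mul_assoc, ← Real.exp_add, neg_add_cancel, Real.exp_zero, mul_one]
      _ ≤ _ := mul_le_mul_of_nonneg_right h1 (Real.exp_nonneg _)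
  have hbig : Tendsto (fun n => laplace (a n) (x n) ((1 - θ) / 4 * t n)) atTop atTop := by
    refine tendsto_atTop_of_tendsto_sqrt (fun n => laplace_nonneg (ha n) _)
      (tendsto_atTop_mono' _ ?_ hdtop)
    -- For `t n ≥ 4` the floor of `t n / 2` is at least `t n / 4`.
    filter_upwards [htop.eventually_ge_atTop 4] with n hn
    rw [← hcts]
    refine ((hK n).discDist_le_ctsDist (μ n) hθ _).trans ((hK n).antitone_ctsDist (μ n) ?_)
    have h1 := Nat.sub_one_lt_floor ((1 - 1 / 2) * t n)
    have h2 : (1 - θ) * (t n / 4) ≤ (1 - θ) * ⌊(1 - 1 / 2) * t n⌋₊ :=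
      mul_le_mul_of_nonneg_left (by linarith) hκ.le
    linarith
  obtain ⟨s, hs0, hs⟩ := exists_laplace_cutoff ha hx0 ht hlow (by positivity) hbig
  refine ⟨s, hs0, fun c hc => ?_⟩
  simp only [hcts]
  exact ⟨tendsto_sqrt_zero (hs c hc).1, Real.tendsto_sqrt_atTop.comp (hs c hc).2⟩

theorem discCutoff_of_ctsCutoff (hK : ∀ n, IsReversibleChain (K n) (π n)) (μ : ∀ n, S n → ℝ)
    {θ : ℝ} (hθ : 1 / 2 < θ) (hθ1 : θ < 1) (hcut : CtsCutoff (ctsFamDist μ K π)) :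
    DiscCutoff (lazyFamDist θ μ K π) := by
  obtain ⟨t, ht, htc⟩ := hcut
  obtain ⟨hd0, hdtop⟩ := htc (1 / 2) ⟨by norm_num, by norm_num⟩
  have hκ : 0 < 1 - θ := by linarith
  choose a x ha hx0 hx2 hd hc using fun n => (hK n).exists_spectral (μ n)
  have hcts : ∀ n s, ctsFamDist μ K π n s = √(laplace (a n) (x n) s) := fun n s => hc n s
  simp only [hcts] at hd0 hdtop
  have hd0' := tendsto_zero_of_tendsto_sqrt (fun n => laplace_nonneg (ha n) _) hd0
  have hdtop' := tendsto_atTop_of_tendsto_sqrt (fun n => laplace_nonneg (ha n) _) hdtop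
  set C := -Real.log (2 * θ - 1) / 2
  have hC : 0 < C := by
    have := Real.log_neg (by linarith : 0 < 2 * θ - 1) (by linarith)
    simp only [C]
    linarith
  -- Effective rates turning the lazy distance into a Laplace transform at integer times; the
  -- logarithm is of a positive number because `θ > 1/2`.
  set ρ : ∀ n, S n → ℝ := fun n i => -Real.log (1 - (1 - θ) * x n i)
  have hq : ∀ n i, 0 < 1 - (1 - θ) * x n i := fun n i =>
    (Real.exp_pos _).trans_le (exp_le_one_sub hθ (hx0 n i) (hx2 n i))
  have hρle : ∀ n i, ρ n i ≤ C * x n i := fun n i =>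
    neg_le.1 ((Real.le_log_iff_exp_le (hq n i)).2 (exp_le_one_sub hθ (hx0 n i) (hx2 n i)))
  have hleρ : ∀ n i, (1 - θ) * x n i ≤ ρ n i := fun n i => by
    have := Real.log_le_sub_one_of_pos (hq n i)
    simp only [ρ]
    linarith
  have hρ0 : ∀ n i, 0 ≤ ρ n i := fun n i => (mul_nonneg hκ.le (hx0 n i)).trans (hleρ n i)
  have hdisc : ∀ n (m : ℕ), lazyFamDist θ μ K π n m = √(laplace (a n) (ρ n) m) := by
    intro n m
    refine (hd n θ m).trans (congrArg _ (Finset.sum_congr rfl fun i _ => ?_))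
    rw [← Real.exp_log (pow_pos (hq n i) (2 * m)), Real.log_pow]
    congr 2
    push_cast
    ring
  have hlow : ∀ M, 0 < M → Tendsto (fun n => lowMass (a n) (ρ n) (M / t n)) atTop (𝓝 0) := by
    intro M hM
    have h0 := hd0'.mul_const (Real.exp (3 * (M / (1 - θ))))
    rw [zero_mul] at h0
    refine squeeze_zero (fun n => lowMass_nonneg (ha n) _) (fun n => ?_) h0
    have h1 : lowMass (a n) (ρ n) (M / t n) ≤ lowMass (a n) (x n) (M / (1 - θ) / t n) :=
      lowMass_le_lowMass (ha n) fun i hi => by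
        rw [div_right_comm, le_div_iff₀' hκ]
        exact (hleρ n i).trans hi
    have h2 := lowMass_mul_exp_le (x := x n) (ha n)
      (mul_nonneg (by norm_num : (0 : ℝ) ≤ 1 + 1 / 2) (ht n).le) (M / (1 - θ) / t n)
    have h3 : -2 * ((1 + 1 / 2) * t n) * (M / (1 - θ) / t n) = -(3 * (M / (1 - θ))) := by
      have := (ht n).ne'
      field_simp
      norm_num
    rw [h3] at h2
    calc _ ≤ lowMass (a n) (x n) (M / (1 - θ) / t n) := h1
      _ = lowMass (a n) (x n) (M / (1 - θ) / t n) * Real.exp (-(3 * (M / (1 - θ)))) *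
          Real.exp (3 * (M / (1 - θ))) := by
          rw [mul_assoc, ← Real.exp_add, neg_add_cancel, Real.exp_zero, mul_one]
      _ ≤ _ := mul_le_mul_of_nonneg_right h2 (Real.exp_nonneg _)
  -- The factor `1 / (2 * C)` is chosen so that `ρ ≤ C * x` gives a comparison with the continuous
  -- chain at `t n / 2`.
  have hbig : Tendsto (fun n => laplace (a n) (ρ n) (1 / (2 * C) * t n)) atTop atTop := by
    refine tendsto_atTop_mono (fun n => laplace_le_laplace (ha n) fun i => ?_) hdtop'
    calc 1 / (2 * C) * t n * ρ n i ≤ 1 / (2 * C) * t n * (C * x n i) :=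
          mul_le_mul_of_nonneg_left (hρle n i) (mul_nonneg (by positivity) (ht n).le)
      _ = (1 - 1 / 2) * t n * x n i := by field_simp; ring
  obtain ⟨s, hs0, hs⟩ := exists_laplace_cutoff ha hρ0 ht hlow (by positivity) hbig
  refine ⟨s, hs0, fun c hc => ?_⟩
  simp only [hdisc]
  -- Both roundings go the favourable way for a decreasing transform.
  constructor
  · refine squeeze_zero (fun n => Real.sqrt_nonneg _) (fun n => ?_) (tendsto_sqrt_zero (hs c hc).1)
    exact Real.sqrt_le_sqrt (laplace_antitone (ha n) (hρ0 n) (Nat.le_ceil _))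
  · refine tendsto_atTop_mono (fun n => ?_) (Real.tendsto_sqrt_atTop.comp (hs c hc).2)
    exact Real.sqrt_le_sqrt (laplace_antitone (ha n) (hρ0 n)
      (Nat.floor_le (mul_nonneg (by linarith [hc.2]) (hs0 n).le)))

end Families

end L2Cutoff

/-! ### The main theorem -/

theorem mainTheorem4 {S : ℕ → Type*} [∀ n, Fintype (S n)] [∀ n, DecidableEq (S n)]
    (μ : ∀ n, S n → ℝ) (K : ∀ n, Matrix (S n) (S n) ℝ) (π : ∀ n, S n → ℝ)
    (hμ : ∀ n, μ n ∈ stdSimplex ℝ (S n))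
    (hK : ∀ n, L2Cutoff.IsReversibleChain (K n) (π n))
    (hdens : Tendsto (fun n => L2Cutoff.densitySq (μ n) (π n)) atTop atTop) :
    (∀ θ ∈ Ico (1 / 2 : ℝ) 1,
      L2Cutoff.DiscCutoff (L2Cutoff.lazyFamDist θ μ K π) →
      (∃ ε₀ : ℝ, 0 < ε₀ ∧ Tendsto (L2Cutoff.lazyMixing θ μ K π ε₀) atTop (𝓝 ∞)) →
      L2Cutoff.CtsCutoff (L2Cutoff.ctsFamDist μ K π)) ∧
    (L2Cutoff.CtsCutoff (L2Cutoff.ctsFamDist μ K π) →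
      (∃ ε₀ : ℝ, 0 < ε₀ ∧ Tendsto (L2Cutoff.contMixing μ K π ε₀) atTop (𝓝 ∞)) →
      ∀ θ ∈ Ioo (1 / 2 : ℝ) 1, L2Cutoff.DiscCutoff (L2Cutoff.lazyFamDist θ μ K π)) ∧
    (∀ θ ∈ Ioo (1 / 2 : ℝ) 1,
      L2Cutoff.CtsCutoff (L2Cutoff.ctsFamDist μ K π) →
      L2Cutoff.DiscCutoff (L2Cutoff.lazyFamDist θ μ K π) →
      (∃ ε₀ : ℝ, 0 < ε₀ ∧
        (Tendsto (L2Cutoff.contMixing μ K π ε₀) atTop (𝓝 ∞) ∨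
          Tendsto (L2Cutoff.lazyMixing θ μ K π ε₀) atTop (𝓝 ∞))) →
      ∀ ε : ℝ, 0 < ε →
        ENNReal.ofReal (1 - θ) ≤
          liminf (fun n => L2Cutoff.contMixing μ K π ε n / L2Cutoff.lazyMixing θ μ K π ε n)
            atTop ∧
        liminf (fun n => L2Cutoff.contMixing μ K π ε n / L2Cutoff.lazyMixing θ μ K π ε n) atTop ≤
          limsup (fun n => L2Cutoff.contMixing μ K π ε n / L2Cutoff.lazyMixing θ μ K π ε n)
            atTop ∧
        limsup (fun n => L2Cutoff.contMixing μ K π ε n / L2Cutoff.lazyMixing θ μ K π ε n) atTop ≤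
          ENNReal.ofReal (-Real.log (2 * θ - 1) / 2)) := by
  refine ⟨fun θ hθ hcut ⟨ε, hε, hT⟩ =>
      L2Cutoff.ctsCutoff_of_discCutoff hK μ hθ.1 hθ.2 hcut hε hT,
    fun hcut _ θ hθ => L2Cutoff.discCutoff_of_ctsCutoff hK μ hθ.1 hθ.2 hcut, ?_⟩
  rintro θ ⟨hθ, hθ1⟩ - ⟨t, ht, htc⟩ ⟨ε₀, hε₀, hT₀⟩ ε hε
  obtain ⟨hd0, hdtop⟩ := htc (1 / 2) ⟨by norm_num, by norm_num⟩
  have hC : 0 < -Real.log (2 * θ - 1) / 2 := by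
    have := Real.log_neg (by linarith : 0 < 2 * θ - 1) (by linarith)
    linarith
  have hupper : ∀ ε n, L2Cutoff.contMixing μ K π ε n ≤
      ENNReal.ofReal (-Real.log (2 * θ - 1) / 2) * L2Cutoff.lazyMixing θ μ K π ε n := fun ε n =>
    L2Cutoff.ctsMixing_le_mul_discMixing hC ((hK n).ctsDist_le_discDist (μ n) hθ) ε
  -- The upper comparison forces the lazy mixing time to diverge whenever the continuous one does.
  have hT₁ : Tendsto (L2Cutoff.lazyMixing θ μ K π ε₀) atTop (𝓝 ∞) := by
    rcases hT₀ with hT | hT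
    · have h1 : Tendsto (fun n => L2Cutoff.contMixing μ K π ε₀ n /
          ENNReal.ofReal (-Real.log (2 * θ - 1) / 2)) atTop (𝓝 ∞) := by
        simpa [ENNReal.top_div] using
          ENNReal.Tendsto.div_const hT (b := ENNReal.ofReal (-Real.log (2 * θ - 1) / 2))
            (Or.inl ENNReal.top_ne_zero)
      exact tendsto_nhds_top_mono h1 (Eventually.of_forall fun n =>
        ENNReal.div_le_of_le_mul' (hupper ε₀ n))
    · exact hT
  have htop := L2Cutoff.tendsto_atTop_of_discMixing ht hd0 hε₀ hT₁
  have hT : Tendsto (L2Cutoff.lazyMixing θ μ K π ε) atTop (𝓝 ∞) :=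
    L2Cutoff.tendsto_discMixing_of_tendsto_atTop
      (fun n => (hK n).antitone_discDist (μ n) hθ.le hθ1.le) htop hdtop ε
  refine ⟨L2Cutoff.le_liminf_div_of_mul_sub_le ENNReal.ofReal_ne_top (fun n => ?_) hT
    (L2Cutoff.discMixing_eventually_ne_top hd0 hε), liminf_le_limsup, ?_⟩
  · exact L2Cutoff.mul_discMixing_sub_le_ctsMixing (by linarith) ((hK n).antitone_ctsDist (μ n))
      ((hK n).discDist_le_ctsDist (μ n) hθ.le) ε
  · exact limsup_le_of_le (h := Eventually.of_forall fun n =>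
      ENNReal.div_le_of_le_mul (hupper ε n))
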